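/- For a Young diagram $\lambda$ with $n$ boxes let $\rho^\lambda$ be the corresponding irreducible complex representation of the symmetric group $S_n$ (realized on the left ideal $\mathbb{C}[S_n]\,b_\lambda a_\lambda$ generated by the Young symmetrizer, where, after numbering the boxes of $\lambda$, $a_\lambda$ is the sum of the row-preserving permutations and $b_\lambda$ is the signed sum of the column-preserving permutations). For $l\le n$ and $\pi\in S_l$, with $\pi$ regarded as an element of $S_n$ fixing $l+1,\dots,n$, define the normalized character $$\Sigma^{\lambda}(\pi)=n(n-1)\cdots(n-l+1)\,\frac{\operatorname{Tr}\rho^{\lambda}(\pi)}{\operatorname{Tr}\rho^{\lambda}(e)}.$$ Let $\mathbf p=(p_1,\dots,p_r)$ and $\mathbf q=(q_1,\dots,q_r)$ be sequences of positive integers with $q_1\ge\cdots\ge q_r$, and let $$\mathbf p\times\mathbf q=(\underbrace{q_1,\dots,q_1}_{p_1\text{ times}},\underbrace{q_2,\dots,q_2}_{p_2\text{ times}},\dots,\underbrace{q_r,\dots,q_r}_{p_r\text{ times}})$$ be the multirectangular partition, which has $n=p_1q_1+\cdots+p_rq_r$ boxes. Denote by $C(\sigma)$ the set of cycles of a permutation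 $\sigma$ (fixed points included). Let $S(l)^{(r)}$ be the set of colored permutations, i.e. pairs $(\sigma,\varphi)$ with $\sigma\in S_l$ and $\varphi:\{1,\dots,l\}\to\{1,\dots,r\}$ constant on each cycle of $\sigma$; write $\varphi(b)$ for the value of $\varphi$ on a cycle $b\in C(\sigma)$. **Theorem (Stanley–Féray character formula).** For every $l\le n$ and every $\pi\in S_l$, $$\Sigma^{\mathbf p\times\mathbf q}(\pi)=(-1)^l\sum_{(\sigma,\varphi)\in S(l)^{(r)}}\ \prod_{b\in C(\sigma)}p_{\varphi(b)}\ \prod_{c\in C(\sigma\pi)}\bigl(-q_{\psi(c)}\bigr),$$ where, for each $(\sigma,\varphi)$, the coloring $\psi$ of the cycles of $\sigma\pi$ is given by $\psi(c)=\max_{a\in c}\varphi(a)$ for $c\in C(\sigma\pi)$. -/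

import Mathlib

namespace StanleyFeray

noncomputable section

/-! ## The irreducible representation attached to a Young diagram

Young diagrams are Mathlib's `YoungDiagram`: a box is a pair `(i, j)` with `i` the index of its row
and `j` the index of its column (both counted from zero). -/

/-- The set of boxes of `μ`, as a type. -/
abbrev Box (μ : YoungDiagram) : Type := {x : ℕ × ℕ // x ∈ μ.cells}

/-- The permutations of the boxes of `μ` that preserve each row. -/
def rowStabilizer (μ : YoungDiagram) : Finset (Equiv.Perm (Box μ)) :=
  Finset.univ.filter fun σ => ∀ x : Box μ, (σ x).1.1 = x.1.1

/-- The permutations of the boxes of `μ` that preserve each column. -/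
def colStabilizer (μ : YoungDiagram) : Finset (Equiv.Perm (Box μ)) :=
  Finset.univ.filter fun σ => ∀ x : Box μ, (σ x).1.2 = x.1.2

/-- `a_μ`, the sum of all row-preserving permutations in the group algebra. -/
def rowSymmetrizer (μ : YoungDiagram) : MonoidAlgebra ℂ (Equiv.Perm (Box μ)) :=
  ∑ σ ∈ rowStabilizer μ, MonoidAlgebra.single σ (1 : ℂ)

/-- `b_μ`, the signed sum of all column-preserving permutations in the group algebra. -/
def colAntisymmetrizer (μ : YoungDiagram) : MonoidAlgebra ℂ (Equiv.Perm (Box μ)) :=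
  ∑ σ ∈ colStabilizer μ, MonoidAlgebra.single σ (((Equiv.Perm.sign σ : ℤ)) : ℂ)

/-- The Young symmetrizer `c_μ = b_μ a_μ`. -/
def youngSymmetrizer (μ : YoungDiagram) : MonoidAlgebra ℂ (Equiv.Perm (Box μ)) :=
  colAntisymmetrizer μ * rowSymmetrizer μ

/-- The left ideal of the group algebra generated by the Young symmetrizer (`Ideal` means left
ideal over a noncommutative ring). -/
abbrev spechtModule (μ : YoungDiagram) : Ideal (MonoidAlgebra ℂ (Equiv.Perm (Box μ))) :=
  Ideal.span {youngSymmetrizer μ}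

/-- The symmetric group on the boxes of `μ` acting on the left ideal by left multiplication. -/
def boxRep (μ : YoungDiagram) :
    Representation ℂ (Equiv.Perm (Box μ)) (spechtModule μ) :=
  Representation.ofModule' (spechtModule μ)

/-- A numbering of the boxes of `μ`. Another numbering leads to an isomorphic representation of the
symmetric group on `μ.card` letters. -/
def numbering (μ : YoungDiagram) : Fin μ.card ≃ Box μ :=
  μ.cells.equivFin.symm

/-- The irreducible representation `ρ^μ` of the symmetric group `S_n`, where `n` is the number of
boxes of `μ`. -/
def rho (μ : YoungDiagram) :
    Representation ℂ (Equiv.Perm (Fin μ.card)) (spechtModule μ) :=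
  (boxRep μ).comp (numbering μ).permCongrHom.toMonoidHom

/-- The character `Tr ρ^μ(g) / Tr ρ^μ(e)`. -/
def chi (μ : YoungDiagram) (g : Equiv.Perm (Fin μ.card)) : ℂ :=
  (rho μ).character g / (rho μ).character 1

/-- The normalized character `Σ^μ(π) = (n)_l χ^μ(π)` for `π ∈ S_l` and `l ≤ n`, where `π` acts on
the first `l` of the `n` letters and fixes the others. -/
def normalizedCharacter (μ : YoungDiagram) {l : ℕ} (hl : l ≤ μ.card)
    (π : Equiv.Perm (Fin l)) : ℂ :=
  (μ.card.descFactorial l : ℂ) * chi μ (π.viaFintypeEmbedding (Fin.castLEEmb hl))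

/-! ## Multirectangular diagrams -/

/-- The list `q₁, …, q₁, q₂, …, q₂, …` in which `qᵢ` is repeated `pᵢ` times. -/
def multirectRows {r : ℕ} (p q : Fin r → ℕ) : List ℕ :=
  (List.ofFn fun i => List.replicate (p i) (q i)).flatten

theorem multirectRows_sorted {r : ℕ} (p q : Fin r → ℕ) (hq : Antitone q) :
    (multirectRows p q).SortedGE := by
  rw [List.sortedGE_iff_pairwise, multirectRows, List.pairwise_flatten]
  constructor
  · intro l hl
    obtain ⟨i, rfl⟩ := (List.mem_ofFn' _ _).1 hl
    simp [List.pairwise_replicate]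
  · rw [List.pairwise_ofFn]
    intro i j hij x hx y hy
    rw [List.eq_of_mem_replicate hx, List.eq_of_mem_replicate hy]
    exact hq hij.le

/-- The diagram `p × q` with `p₁` rows of length `q₁`, then `p₂` rows of length `q₂`, and so on. -/
def multirect {r : ℕ} (p q : Fin r → ℕ) (hq : Antitone q) : YoungDiagram :=
  YoungDiagram.ofRowLens (multirectRows p q) (multirectRows_sorted p q hq)

/-! ## Colored permutations -/

/-- `C(σ)`, the set of cycles of `σ`, fixed points included. -/
abbrev Cycles {l : ℕ} (σ : Equiv.Perm (Fin l)) : Type :=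
  Quotient (Equiv.Perm.SameCycle.setoid σ)

instance cyclesFintype {l : ℕ} (σ : Equiv.Perm (Fin l)) : Fintype (Cycles σ) :=
  Fintype.ofFinite _

/-- `S(l)^{(r)}`: pairs of a permutation and a coloring of the letters that is constant on each of
its cycles. -/
abbrev ColoredPerm (l r : ℕ) : Type :=
  {x : Equiv.Perm (Fin l) × (Fin l → Fin r) //
    ∀ a b, x.1.SameCycle a b → x.2 a = x.2 b}

namespace ColoredPerm

variable {l r : ℕ}

/-- The underlying permutation. -/
abbrev perm (x : ColoredPerm l r) : Equiv.Perm (Fin l) := x.1.1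

/-- The coloring, as a function on the set of cycles. -/
def color (x : ColoredPerm l r) (c : Cycles (perm x)) : Fin r :=
  Quotient.lift x.1.2 (fun a b h => x.2 a b h) c

/-- The product `(σ, φ) · π = (σ π, ψ)`: the color of `a` is the maximum of `φ` over the cycle of
`σ π` that contains `a`. -/
def mulPerm (x : ColoredPerm l r) (π : Equiv.Perm (Fin l)) : ColoredPerm l r :=
  ⟨(perm x * π, fun a =>
      (Finset.univ.filter fun b => (perm x * π).SameCycle a b).sup'
        ⟨a, by simp [Equiv.Perm.SameCycle.refl]⟩ x.1.2),
    fun a b h => by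
      have key : (Finset.univ.filter fun c => (perm x * π).SameCycle a c) =
          Finset.univ.filter fun c => (perm x * π).SameCycle b c := by
        ext c
        simp only [Finset.mem_filter, Finset.mem_univ, true_and]
        exact ⟨fun hc => h.symm.trans hc, fun hc => h.trans hc⟩
      exact Finset.sup'_congr ⟨a, by simp [Equiv.Perm.SameCycle.refl]⟩ key fun _ _ => rfl⟩

end ColoredPerm

end

end StanleyFeray

/-! The Young symmetrizer `c` satisfies `c * c = α • c` with `α ≠ 0`, so right multiplication by
`α⁻¹ • c` projects the group algebra onto the left ideal. The character is therefore a trace on the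
whole group algebra, namely `α⁻¹` times a sum of coefficients of `c` over conjugates. Since `c` has
coefficient 1 at the identity, `α` cancels in the ratio `chi` (`chi_eq_sum_coeff`).

Averaging over conjugates by all permutations becomes a sum over injective labellings `f : Fin l ↪
Box μ`. The coefficient of `c` is then a signed sum over `σ` preserving the rows of `f` with `σ * π`
preserving its columns. Non-injective labellings contribute zero by a sign-reversing involution, so
all functions `f` may be allowed (`normalizedCharacter_eq_sum`).

For fixed `σ`, such an `f` is a row for each cycle of `σ` and a column for each cycle of `σ * π`. In
`p × q`, a row is a color `k` and one of `p k` indices. The column of a cycle must fit in every row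
the cycle meets, hence in the shortest, which has the maximal color (`card_labelling`). The sign of
`σ * π` supplies the signs in front of the `q`'s. -/

namespace StanleyFeray

open Equiv Finset

noncomputable section

/-! ### Traces on the group algebra and quasi-idempotents. -/

section GroupAlgebra

variable {G : Type*} [Group G]

/-- Multiplication by `x` on the left and by `y` on the right. -/
def mulLeftRight (x y : MonoidAlgebra ℂ G) : MonoidAlgebra ℂ G →ₗ[ℂ] MonoidAlgebra ℂ G :=
  LinearMap.mulLeft ℂ x ∘ₗ LinearMap.mulRight ℂ y

theorem coeff_single_mul_mul (g h : G) (x : MonoidAlgebra ℂ G) (k : G) :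
    (MonoidAlgebra.single g 1 * (MonoidAlgebra.single h 1 * x)).coeff k
      = x.coeff (h⁻¹ * g⁻¹ * k) := by
  simp [mul_assoc]

variable [Fintype G]

/-- In the basis of group elements, the diagonal entry at `h` is the coefficient of `h` in `g h y`.
-/
theorem trace_mulLeftRight (g : G) (y : MonoidAlgebra ℂ G) :
    LinearMap.trace ℂ _ (mulLeftRight (MonoidAlgebra.single g 1) y)
      = ∑ h : G, y.coeff (h⁻¹ * g⁻¹ * h) := by
  classical
  rw [LinearMap.trace_eq_matrix_trace ℂ (MonoidAlgebra.basis G ℂ), Matrix.trace]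
  refine Finset.sum_congr rfl fun h _ => ?_
  rw [Matrix.diag_apply, LinearMap.toMatrix_apply]
  exact coeff_single_mul_mul g h y h

instance : Module.Finite ℂ (MonoidAlgebra ℂ G) :=
  Module.Finite.of_basis (MonoidAlgebra.basis G ℂ)

/-- If `α = 0`, right multiplication by `c` squares to zero and so has trace zero; but its trace is
the group order times `c.coeff 1`. -/
theorem quasiIdempotent_ne_zero {c : MonoidAlgebra ℂ G} {α : ℂ} (hc : c * c = α • c)
    (h1 : c.coeff 1 ≠ 0) : α ≠ 0 := by
  classical
  rintro rfl
  have hn : IsNilpotent (mulLeftRight (MonoidAlgebra.single (1 : G) 1) c) := by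
    refine ⟨2, ?_⟩
    ext x
    simp [pow_two, mulLeftRight, mul_assoc, hc, ← MonoidAlgebra.one_def]
  have := (LinearMap.isNilpotent_trace_of_isNilpotent hn).eq_zero
  rw [trace_mulLeftRight] at this
  simp [h1] at this

/-- The character of the left ideal generated by a quasi-idempotent. -/
theorem trace_ofModule'_span {c : MonoidAlgebra ℂ G} {α : ℂ} (hc : c * c = α • c) (hα : α ≠ 0)
    (g : G) :
    LinearMap.trace ℂ _ (Representation.ofModule' (k := ℂ) (G := G)
        (Ideal.span {c} : Ideal (MonoidAlgebra ℂ G)) g)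
      = α⁻¹ * ∑ h : G, c.coeff (h⁻¹ * g⁻¹ * h) := by
  set I : Ideal (MonoidAlgebra ℂ G) := Ideal.span {c} with hI
  let ι : I →ₗ[ℂ] MonoidAlgebra ℂ G := I.subtype.restrictScalars ℂ
  let P : MonoidAlgebra ℂ G →ₗ[ℂ] I :=
    (LinearMap.mulRight ℂ (α⁻¹ • c)).codRestrict (I.restrictScalars ℂ) fun x => by
      have : x * (α⁻¹ • c) = (α⁻¹ • x) * c := by simp
      rw [LinearMap.mulRight_apply, this]
      exact I.mul_mem_left _ (Ideal.subset_span rfl)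
  have hP : ∀ x : I, P (ι x) = x := by
    rintro ⟨x, hx⟩
    obtain ⟨a, rfl⟩ := Ideal.mem_span_singleton'.1 hx
    refine Subtype.ext ?_
    change a * c * (α⁻¹ • c) = a * c
    rw [mul_smul_comm, mul_assoc, hc, mul_smul_comm, smul_smul, inv_mul_cancel₀ hα, one_smul]
  set T := Representation.ofModule' (k := ℂ) (G := G) I g
  have hT : T = P ∘ₗ (ι ∘ₗ T) := by
    ext x
    rw [LinearMap.comp_apply, LinearMap.comp_apply, hP]
  have : Module.Finite ℂ I := Module.Finite.of_surjective P fun x => ⟨ι x, hP x⟩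
  -- Cyclicity of the trace moves the computation from the ideal to the full group algebra, where a
  -- basis is at hand.
  rw [hT, LinearMap.trace_comp_comm']
  have : (ι ∘ₗ T) ∘ₗ P = α⁻¹ • mulLeftRight (MonoidAlgebra.single g 1) c := by
    refine LinearMap.ext fun x => ?_
    have hg : ∀ y : I, ι (T y) = MonoidAlgebra.single g 1 * ι y := by
      intro y
      simp [T, ι, Representation.ofModule']
    rw [LinearMap.comp_apply, LinearMap.comp_apply, hg]
    change _ * (_ * (α⁻¹ • c)) = α⁻¹ • (_ * (_ * c))
    simp
  rw [this, map_smul, trace_mulLeftRight, smul_eq_mul]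

end GroupAlgebra

/-! ### Finite sets of naturals with minimal sum. -/

section Finset

/-- The elements of `s` outside `range #s` are at least `#s` and replace equally many missing ones,
all below `#s`; each replacement gains at least one. -/
theorem sum_range_card_add_card_sdiff_le (s : Finset ℕ) :
    ∑ i ∈ range #s, i + #(s \ range #s) ≤ ∑ i ∈ s, i := by
  have hc : #(s \ range #s) = #(range #s \ s) := card_sdiff_comm (by simp)
  have h1 : #(s \ range #s) * #s ≤ ∑ i ∈ s \ range #s, i := by
    rw [← smul_eq_mul]
    refine card_nsmul_le_sum _ _ _ fun x hx => ?_
    simpa using (mem_sdiff.1 hx).2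
  have h2 : ∑ i ∈ range #s \ s, (i + 1) ≤ #(range #s \ s) * #s := by
    rw [← smul_eq_mul]
    refine sum_le_card_nsmul _ _ _ fun x hx => ?_
    simpa [Nat.succ_le_iff] using (mem_sdiff.1 hx).1
  rw [sum_add_distrib, sum_const, smul_eq_mul, mul_one] at h2
  have h3 := sum_inter_add_sum_sdiff s (range #s) (fun i : ℕ => i)
  have h4 := sum_inter_add_sum_sdiff (range #s) s (fun i : ℕ => i)
  rw [inter_comm] at h4
  rw [← hc] at h2
  omega

theorem eq_range_card_of_sum_eq {s : Finset ℕ} (h : ∑ i ∈ range #s, i = ∑ i ∈ s, i) :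
    s = range #s := by
  have := sum_range_card_add_card_sdiff_le s
  have h0 : s \ range #s = ∅ := card_eq_zero.1 (by omega)
  exact eq_of_subset_of_card_le (sdiff_eq_empty_iff_subset.1 h0) (by simp)

end Finset

/-! ### The Young symmetrizer is a quasi-idempotent. -/

section YoungSymmetrizer

variable {μ : YoungDiagram}

theorem mem_rowStabilizer {σ : Perm (Box μ)} :
    σ ∈ rowStabilizer μ ↔ ∀ x, (σ x).1.1 = x.1.1 := by
  simp [rowStabilizer]

theorem mem_colStabilizer {σ : Perm (Box μ)} :
    σ ∈ colStabilizer μ ↔ ∀ x, (σ x).1.2 = x.1.2 := by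
  simp [colStabilizer]

theorem inv_mem_rowStabilizer {σ : Perm (Box μ)} (h : σ ∈ rowStabilizer μ) :
    σ⁻¹ ∈ rowStabilizer μ := by
  rw [mem_rowStabilizer] at h ⊢
  intro x
  simpa using (h (σ⁻¹ x)).symm

theorem inv_mem_colStabilizer {σ : Perm (Box μ)} (h : σ ∈ colStabilizer μ) :
    σ⁻¹ ∈ colStabilizer μ := by
  rw [mem_colStabilizer] at h ⊢
  intro x
  simpa using (h (σ⁻¹ x)).symm

theorem mul_mem_rowStabilizer_iff {σ τ : Perm (Box μ)} (h : τ ∈ rowStabilizer μ) :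
    σ * τ ∈ rowStabilizer μ ↔ σ ∈ rowStabilizer μ := by
  simp only [mem_rowStabilizer, Perm.mul_apply] at h ⊢
  exact ⟨fun H x => by simpa [h] using (H (τ⁻¹ x)).trans (h (τ⁻¹ x)).symm,
    fun H x => (H _).trans (h x)⟩

theorem mul_mem_colStabilizer_iff {σ τ : Perm (Box μ)} (h : σ ∈ colStabilizer μ) :
    σ * τ ∈ colStabilizer μ ↔ τ ∈ colStabilizer μ := by
  simp only [mem_colStabilizer, Perm.mul_apply] at h ⊢
  simp [h]

theorem eq_one_of_mem_stabilizers {σ : Perm (Box μ)} (hr : σ ∈ rowStabilizer μ)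
    (hc : σ ∈ colStabilizer μ) : σ = 1 := by
  ext x : 1
  exact Subtype.ext (Prod.ext (mem_rowStabilizer.1 hr x) (mem_colStabilizer.1 hc x))

/-- The boxes in column `j`. -/
def columnBoxes (μ : YoungDiagram) (j : ℕ) : Finset (Box μ) :=
  univ.filter fun x => x.1.2 = j

theorem image_row_columnBoxes (j : ℕ) :
    (columnBoxes μ j).image (fun x => x.1.1) = range (μ.colLen j) := by
  ext i
  simp only [columnBoxes, mem_image, mem_filter, mem_univ, true_and, mem_range,
    ← YoungDiagram.mem_iff_lt_colLen]
  constructor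
  · rintro ⟨x, rfl, rfl⟩
    exact x.2
  · intro h
    exact ⟨⟨(i, j), h⟩, rfl, rfl⟩

theorem injOn_row_columnBoxes (j : ℕ) :
    Set.InjOn (fun x : Box μ => x.1.1) (columnBoxes μ j) := by
  intro x hx y hy h
  simp only [columnBoxes, coe_filter, mem_univ, true_and, Set.mem_ofPred_eq] at hx hy
  exact Subtype.ext (Prod.ext h (hx.trans hy.symm))

theorem card_columnBoxes (j : ℕ) : #(columnBoxes μ j) = μ.colLen j := by
  rw [← card_image_of_injOn (injOn_row_columnBoxes j), image_row_columnBoxes, card_range]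

theorem sum_eq_sum_columnBoxes (f : Box μ → ℕ) :
    ∑ x, f x = ∑ j ∈ univ.image (fun x : Box μ => x.1.2), ∑ x ∈ columnBoxes μ j, f x :=
  (sum_fiberwise_of_maps_to (fun _ hx => mem_image_of_mem _ hx) f).symm

/-- If boxes in a common column are never sent by `w⁻¹` to a common row, then `w` is the product of
a column-preserving and a row-preserving permutation. -/
theorem exists_col_mul_row {w : Perm (Box μ)}
    (H : ∀ x y : Box μ, x.1.2 = y.1.2 → (w⁻¹ x).1.1 = (w⁻¹ y).1.1 → x = y) :
    ∃ q ∈ colStabilizer μ, ∃ p ∈ rowStabilizer μ, w = q * p := by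
  set label : Box μ → ℕ := fun x => (w⁻¹ x).1.1 with hlabel
  have hinj : ∀ j, Set.InjOn label (columnBoxes μ j) := by
    intro j x hx y hy h
    simp only [columnBoxes, coe_filter, mem_univ, true_and, Set.mem_ofPred_eq] at hx hy
    exact H x y (hx.trans hy.symm) h
  have hcard : ∀ j, #((columnBoxes μ j).image label) = μ.colLen j := fun j => by
    rw [card_image_of_injOn (hinj j), card_columnBoxes]
  have hrow : ∀ j, ∑ x ∈ columnBoxes μ j, x.1.1 = ∑ i ∈ range (μ.colLen j), i := fun j => by
    rw [← image_row_columnBoxes, sum_image (injOn_row_columnBoxes j)]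
  have hlab : ∀ j, ∑ x ∈ columnBoxes μ j, label x = ∑ i ∈ (columnBoxes μ j).image label, i :=
    fun j => by rw [sum_image (hinj j)]
  have hle : ∀ j ∈ univ.image (fun x : Box μ => x.1.2),
      ∑ x ∈ columnBoxes μ j, x.1.1 ≤ ∑ x ∈ columnBoxes μ j, label x := fun j _ => by
    rw [hrow, hlab, ← hcard j]
    exact (Nat.le_add_right _ _).trans (sum_range_card_add_card_sdiff_le _)
  -- Labels in a column are distinct, so their sum is at least that of the row indices there. The
  -- totals agree because `w⁻¹` permutes the boxes, so equality holds in every column and the labels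
  -- fill exactly its row indices.
  have htot : ∑ x : Box μ, x.1.1 = ∑ x : Box μ, label x :=
    (Equiv.sum_comp w⁻¹ fun x : Box μ => x.1.1).symm
  rw [sum_eq_sum_columnBoxes, sum_eq_sum_columnBoxes, sum_eq_sum_iff_of_le hle] at htot
  have hmem : ∀ y : Box μ, (label y, y.1.2) ∈ μ.cells := by
    intro y
    have h := htot y.1.2 (mem_image_of_mem _ (mem_univ y))
    rw [hrow, hlab, ← hcard] at h
    have hy : label y ∈ (columnBoxes μ y.1.2).image label :=
      mem_image_of_mem _ (by simp [columnBoxes])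
    rw [eq_range_card_of_sum_eq h, hcard, mem_range] at hy
    exact YoungDiagram.mem_iff_lt_colLen.2 hy
  -- Moving each box within its column to the row named by its label makes `u ∘ w` preserve rows.
  let u : Box μ → Box μ := fun y => ⟨(label y, y.1.2), hmem y⟩
  have hu : Function.Injective u := by
    intro x y h
    have h' : (label x, x.1.2) = (label y, y.1.2) := congrArg Subtype.val h
    exact H x y (Prod.ext_iff.1 h').2 (Prod.ext_iff.1 h').1
  let U : Perm (Box μ) := Equiv.ofBijective u (Finite.injective_iff_bijective.1 hu)
  refine ⟨U⁻¹, inv_mem_colStabilizer (mem_colStabilizer.2 fun x => rfl), U * w,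
    mem_rowStabilizer.2 fun x => ?_, by simp⟩
  change (w⁻¹ (w x)).1.1 = x.1.1
  simp

/-- The elements of the group algebra that transform by the sign under column-preserving
permutations on the left and are fixed by row-preserving permutations on the right. -/
def IsYoungSemiinvariant (x : MonoidAlgebra ℂ (Perm (Box μ))) : Prop :=
  (∀ q ∈ colStabilizer μ, ∀ w, x.coeff (q * w) = ((Perm.sign q : ℤ) : ℂ) * x.coeff w) ∧
    ∀ p ∈ rowStabilizer μ, ∀ w, x.coeff (w * p) = x.coeff w

/-- A column transposition on the left of `w` equals a row transposition on the right; the first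
negates the coefficient and the second fixes it. -/
theorem IsYoungSemiinvariant.coeff_eq_zero {x : MonoidAlgebra ℂ (Perm (Box μ))}
    (hx : IsYoungSemiinvariant x) {w : Perm (Box μ)} {y z : Box μ} (hne : y ≠ z)
    (hcol : y.1.2 = z.1.2) (hrow : (w⁻¹ y).1.1 = (w⁻¹ z).1.1) : x.coeff w = 0 := by
  have hc : swap y z ∈ colStabilizer μ :=
    mem_colStabilizer.2 fun _ => apply_swap_eq_self (v := fun x : Box μ => x.1.2) hcol _
  have hr : swap (w⁻¹ y) (w⁻¹ z) ∈ rowStabilizer μ :=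
    mem_rowStabilizer.2 fun _ => apply_swap_eq_self (v := fun x : Box μ => x.1.1) hrow _
  have h1 := hx.2 _ hr w
  have h2 := hx.1 _ hc w
  have : w * swap (w⁻¹ y) (w⁻¹ z) = swap y z * w := by
    rw [mul_swap_eq_swap_mul]; simp
  rw [this, h2, Perm.sign_swap hne] at h1
  have h3 : -x.coeff w = x.coeff w := by simpa using h1
  linear_combination (-1 / 2 : ℂ) * h3

/-- Each `w` is either a column-row product, where the value at 1 determines the coefficient, or
admits the transposition that forces it to vanish. -/
theorem IsYoungSemiinvariant.eq_smul {x y : MonoidAlgebra ℂ (Perm (Box μ))}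
    (hx : IsYoungSemiinvariant x) (hy : IsYoungSemiinvariant y) (h1 : y.coeff 1 = 1) :
    x = x.coeff 1 • y := by
  refine MonoidAlgebra.ext (Finsupp.ext fun w => ?_)
  rw [MonoidAlgebra.coeff_smul, Finsupp.smul_apply, smul_eq_mul]
  by_cases H : ∀ x y : Box μ, x.1.2 = y.1.2 → (w⁻¹ x).1.1 = (w⁻¹ y).1.1 → x = y
  · obtain ⟨q, hq, p, hp, rfl⟩ := exists_col_mul_row H
    rw [hx.2 p hp, hy.2 p hp, ← mul_one q, hx.1 q hq, hy.1 q hq, h1]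
    ring
  · push Not at H
    obtain ⟨u, v, hcol, hrow, hne⟩ := H
    rw [hx.coeff_eq_zero hne hcol hrow, hy.coeff_eq_zero hne hcol hrow, mul_zero]

theorem single_mul_youngSymmetrizer {q : Perm (Box μ)} (hq : q ∈ colStabilizer μ) :
    MonoidAlgebra.single q 1 * youngSymmetrizer μ
      = ((Perm.sign q : ℤ) : ℂ) • youngSymmetrizer μ := by
  rw [youngSymmetrizer, ← mul_assoc, ← smul_mul_assoc]
  congr 1
  rw [colAntisymmetrizer, mul_sum, smul_sum]
  refine sum_equiv (Equiv.mulLeft q) (fun σ => (mul_mem_colStabilizer_iff hq).symm) fun σ _ => ?_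
  rcases Int.units_eq_one_or (Perm.sign q) with h | h <;> simp [h]

theorem youngSymmetrizer_mul_single {p : Perm (Box μ)} (hp : p ∈ rowStabilizer μ) :
    youngSymmetrizer μ * MonoidAlgebra.single p 1 = youngSymmetrizer μ := by
  rw [youngSymmetrizer, mul_assoc]
  congr 1
  rw [rowSymmetrizer, sum_mul]
  exact sum_equiv (Equiv.mulRight p) (fun σ => (mul_mem_rowStabilizer_iff hp).symm)
    fun σ _ => by simp

theorem coeff_youngSymmetrizer (w : Perm (Box μ)) :
    (youngSymmetrizer μ).coeff w = ∑ p ∈ rowStabilizer μ,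
      if w * p⁻¹ ∈ colStabilizer μ then ((Perm.sign (w * p⁻¹) : ℤ) : ℂ) else 0 := by
  rw [youngSymmetrizer, colAntisymmetrizer, rowSymmetrizer, sum_mul_sum, sum_comm,
    MonoidAlgebra.coeff_sum, Finsupp.finsetSum_apply]
  refine sum_congr rfl fun p _ => ?_
  rw [MonoidAlgebra.coeff_sum, Finsupp.finsetSum_apply, ← sum_ite_eq' (colStabilizer μ) (w * p⁻¹)
    fun q => ((Perm.sign q : ℤ) : ℂ)]
  refine sum_congr rfl fun q _ => ?_
  rw [MonoidAlgebra.single_mul_single, mul_one, MonoidAlgebra.coeff_single, Finsupp.single_apply]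
  simp only [eq_mul_inv_iff_mul_eq]

theorem coeff_one_youngSymmetrizer : (youngSymmetrizer μ).coeff 1 = 1 := by
  rw [coeff_youngSymmetrizer, sum_eq_single 1]
  · simp [mem_colStabilizer]
  · intro p hp hp1
    rw [if_neg]
    intro h
    rw [one_mul] at h
    exact hp1 (inv_eq_one.1 (eq_one_of_mem_stabilizers (inv_mem_rowStabilizer hp) h))
  · simp [mem_rowStabilizer]

theorem isYoungSemiinvariant_of_mul {x : MonoidAlgebra ℂ (Perm (Box μ))}
    (hl : ∀ q ∈ colStabilizer μ,
      MonoidAlgebra.single q 1 * x = ((Perm.sign q : ℤ) : ℂ) • x)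
    (hr : ∀ p ∈ rowStabilizer μ, x * MonoidAlgebra.single p 1 = x) :
    IsYoungSemiinvariant x := by
  constructor
  · intro q hq w
    have := congrArg (fun y => y.coeff w) (hl _ (inv_mem_colStabilizer hq))
    simpa using this
  · intro p hp w
    have := congrArg (fun y => y.coeff w) (hr _ (inv_mem_rowStabilizer hp))
    simpa using this

theorem youngSymmetrizer_mul_self :
    youngSymmetrizer μ * youngSymmetrizer μ
      = (youngSymmetrizer μ * youngSymmetrizer μ).coeff 1 • youngSymmetrizer μ := by
  refine IsYoungSemiinvariant.eq_smul (isYoungSemiinvariant_of_mul ?_ ?_)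
    (isYoungSemiinvariant_of_mul (fun q => single_mul_youngSymmetrizer)
      (fun p => youngSymmetrizer_mul_single)) coeff_one_youngSymmetrizer
  · intro q hq
    rw [← mul_assoc, single_mul_youngSymmetrizer hq, smul_mul_assoc]
  · intro p hp
    rw [mul_assoc, youngSymmetrizer_mul_single hp]

theorem chi_eq_sum_coeff (g : Perm (Fin μ.card)) :
    chi μ g = (Nat.factorial μ.card : ℂ)⁻¹ * ∑ h : Perm (Box μ),
      (youngSymmetrizer μ).coeff (h⁻¹ * ((numbering μ).permCongr g)⁻¹ * h) := by
  have hsq := youngSymmetrizer_mul_self (μ := μ)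
  have hα := quasiIdempotent_ne_zero hsq (by rw [coeff_one_youngSymmetrizer]; exact one_ne_zero)
  have hchar : ∀ g, (rho μ).character g = _ := fun g =>
    trace_ofModule'_span hsq hα ((numbering μ).permCongr g)
  have hcard : Fintype.card (Perm (Box μ)) = Nat.factorial μ.card := by
    rw [Fintype.card_perm, Fintype.card_coe, YoungDiagram.card]
  have h1 : (rho μ).character 1 = ((youngSymmetrizer μ * youngSymmetrizer μ).coeff 1)⁻¹ *
      (Nat.factorial μ.card : ℂ) := by
    rw [hchar]
    congr 1
    have : (numbering μ).permCongr 1 = 1 := by ext x : 1; simp [permCongr_apply]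
    simp [this, coeff_one_youngSymmetrizer, hcard]
  rw [chi, h1, hchar]
  field_simp

end YoungSymmetrizer

/-! ### Extending permutations along embeddings. -/

section ViaFintypeEmbedding

variable {α β : Type*} [Fintype α] [DecidableEq β]

theorem viaFintypeEmbedding_mul (σ τ : Perm α) (f : α ↪ β) :
    (σ * τ).viaFintypeEmbedding f = σ.viaFintypeEmbedding f * τ.viaFintypeEmbedding f :=
  (Perm.extendDomain_mul _ _ _).symm

theorem viaFintypeEmbedding_injective (f : α ↪ β) :
    Function.Injective fun σ : Perm α => σ.viaFintypeEmbedding f := by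
  intro σ τ h
  ext a
  apply f.injective
  rw [← Perm.viaFintypeEmbedding_apply_image, ← Perm.viaFintypeEmbedding_apply_image]
  exact congrArg (fun w : Perm β => w (f a)) h

theorem exists_viaFintypeEmbedding_eq {f : α ↪ β} {w : Perm β}
    (h : ∀ x, x ∉ Set.range f → w x = x) : ∃ σ : Perm α, σ.viaFintypeEmbedding f = w := by
  have hmem : ∀ a, ∃ b, f b = w (f a) := by
    intro a
    by_contra hb
    have hb' := w.injective (h (w (f a)) hb)
    exact hb ⟨a, hb'.symm⟩
  choose s hs using hmem
  have hinj : Function.Injective s := by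
    intro a b hab
    apply f.injective
    apply w.injective
    rw [← hs, ← hs, hab]
  refine ⟨Equiv.ofBijective s (Finite.injective_iff_bijective.1 hinj), ?_⟩
  ext x
  by_cases hx : x ∈ Set.range f
  · obtain ⟨a, rfl⟩ := hx
    rw [Perm.viaFintypeEmbedding_apply_image]
    exact hs a
  · rw [Perm.viaFintypeEmbedding_apply_notMem_range _ _ hx, h x hx]

theorem permCongr_viaFintypeEmbedding {γ : Type*} [DecidableEq γ] (e : β ≃ γ) (σ : Perm α)
    (f : α ↪ β) :
    e.permCongr (σ.viaFintypeEmbedding f) = σ.viaFintypeEmbedding (f.trans e.toEmbedding) := by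
  ext x
  rw [permCongr_apply]
  by_cases hx : ∃ a, e (f a) = x
  · obtain ⟨a, rfl⟩ := hx
    rw [symm_apply_apply, Perm.viaFintypeEmbedding_apply_image]
    exact (Perm.viaFintypeEmbedding_apply_image σ (f.trans e.toEmbedding) a).symm
  · rw [Perm.viaFintypeEmbedding_apply_notMem_range, Perm.viaFintypeEmbedding_apply_notMem_range,
      apply_symm_apply]
    · exact hx
    · rintro ⟨a, ha⟩
      exact hx ⟨a, by rw [ha, apply_symm_apply]⟩

/-- Averaging over the permutations of `β` is averaging over the embeddings of `α` into `β`. -/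
theorem card_embedding_mul_sum_perm [Fintype β] (g : α ↪ β) (F : (α ↪ β) → ℂ) :
    (Fintype.card (α ↪ β) : ℂ) * ∑ h : Perm β, F (g.trans h.toEmbedding)
      = (Fintype.card (Perm β) : ℂ) * ∑ f, F f := by
  -- All fibers of `h ↦ h ∘ g` have the same size: a permutation carrying `f` to `g` translates one
  -- onto the other.
  have hconst : ∀ f : α ↪ β, #{h : Perm β | g.trans h.toEmbedding = f}
      = #{h : Perm β | g.trans h.toEmbedding = g} := by
    intro f
    obtain ⟨τ, hτ⟩ := Perm.exists_extending_pair f g f.injective g.injective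
    refine card_equiv (Equiv.mulLeft τ) fun h => ?_
    simp only [mem_filter, mem_univ, true_and, DFunLike.ext_iff, coe_mulLeft,
      Function.Embedding.trans_apply, coe_toEmbedding, Perm.mul_apply, ← hτ, τ.injective.eq_iff]
  have hsum : ∀ F : (α ↪ β) → ℂ, ∑ h : Perm β, F (g.trans h.toEmbedding)
      = (#{h : Perm β | g.trans h.toEmbedding = g} : ℂ) * ∑ f, F f := by
    intro F
    rw [← sum_fiberwise univ fun h : Perm β => g.trans h.toEmbedding, mul_sum]
    refine sum_congr rfl fun f _ => ?_
    rw [sum_congr rfl fun h hh => congrArg F (mem_filter.1 hh).2, sum_const, hconst, nsmul_eq_mul]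
  have h1 := hsum fun _ => 1
  simp only [sum_const, card_univ, nsmul_eq_mul, mul_one] at h1
  rw [hsum, h1]
  ring

end ViaFintypeEmbedding

/-! ### The normalized character as a signed count of labellings. -/

section Functions

variable {μ : YoungDiagram} {l : ℕ}

/-- `σ` preserves the rows and `τ` preserves the columns of the boxes labelled by `f`. -/
def Preserves (f : Fin l → Box μ) (σ τ : Perm (Fin l)) : Prop :=
  (∀ a, (f (σ a)).1.1 = (f a).1.1) ∧ ∀ a, (f (τ a)).1.2 = (f a).1.2

instance (f : Fin l → Box μ) (σ τ : Perm (Fin l)) : Decidable (Preserves f σ τ) :=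
  inferInstanceAs (Decidable (_ ∧ _))

theorem viaFintypeEmbedding_mem_rowStabilizer {f : Fin l ↪ Box μ} {σ : Perm (Fin l)} :
    σ.viaFintypeEmbedding f ∈ rowStabilizer μ ↔ ∀ a, (f (σ a)).1.1 = (f a).1.1 := by
  rw [mem_rowStabilizer]
  refine ⟨fun h a => by simpa using h (f a), fun h x => ?_⟩
  by_cases hx : x ∈ Set.range f
  · obtain ⟨a, rfl⟩ := hx
    simpa using h a
  · rw [Perm.viaFintypeEmbedding_apply_notMem_range _ _ hx]

theorem viaFintypeEmbedding_mem_colStabilizer {f : Fin l ↪ Box μ} {σ : Perm (Fin l)} :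
    σ.viaFintypeEmbedding f ∈ colStabilizer μ ↔ ∀ a, (f (σ a)).1.2 = (f a).1.2 := by
  rw [mem_colStabilizer]
  refine ⟨fun h a => by simpa using h (f a), fun h x => ?_⟩
  by_cases hx : x ∈ Set.range f
  · obtain ⟨a, rfl⟩ := hx
    simpa using h a
  · rw [Perm.viaFintypeEmbedding_apply_notMem_range _ _ hx]

theorem inv_mem_colStabilizer_iff {σ : Perm (Box μ)} :
    σ⁻¹ ∈ colStabilizer μ ↔ σ ∈ colStabilizer μ :=
  ⟨fun h => inv_inv σ ▸ inv_mem_colStabilizer h, inv_mem_colStabilizer⟩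

/-- For a row factor `p`, the column factor is the inverse of `p` times the extended `π`, whence the
condition and the sign on `σ * π`. -/
theorem coeff_youngSymmetrizer_viaFintypeEmbedding (π : Perm (Fin l)) (f : Fin l ↪ Box μ) :
    (youngSymmetrizer μ).coeff (π.viaFintypeEmbedding f)⁻¹
      = ∑ σ : Perm (Fin l),
          if Preserves f σ (σ * π) then ((Perm.sign (σ * π) : ℤ) : ℂ) else 0 := by
  rw [coeff_youngSymmetrizer, ← sum_filter, ← sum_filter]
  symm
  refine sum_nbij (fun σ => σ.viaFintypeEmbedding f) ?_ (viaFintypeEmbedding_injective f).injOn ?_ ?_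
  · intro σ hσ
    rw [mem_filter] at hσ ⊢
    rw [← mul_inv_rev, inv_mem_colStabilizer_iff, ← viaFintypeEmbedding_mul,
      viaFintypeEmbedding_mem_colStabilizer, viaFintypeEmbedding_mem_rowStabilizer]
    exact hσ.2
  · intro p hp
    rw [mem_coe, mem_filter, ← mul_inv_rev, inv_mem_colStabilizer_iff] at hp
    obtain ⟨hr, hc⟩ := hp
    -- Off the range of `f` the extended `π` is trivial, so `p` preserves both the row and the
    -- column of such a box and fixes it.
    obtain ⟨σ, rfl⟩ : ∃ σ : Perm (Fin l), σ.viaFintypeEmbedding f = p := by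
      refine exists_viaFintypeEmbedding_eq fun x hx => ?_
      have h1 := mem_colStabilizer.1 hc x
      rw [Perm.mul_apply, Perm.viaFintypeEmbedding_apply_notMem_range _ _ hx] at h1
      exact Subtype.ext (Prod.ext (mem_rowStabilizer.1 hr x) h1)
    refine ⟨σ, ?_, rfl⟩
    rw [← viaFintypeEmbedding_mul, viaFintypeEmbedding_mem_colStabilizer] at hc
    rw [viaFintypeEmbedding_mem_rowStabilizer] at hr
    rw [mem_coe, mem_filter]
    exact ⟨mem_univ _, hr, hc⟩
  · intro σ _
    rw [← mul_inv_rev, ← viaFintypeEmbedding_mul, Perm.sign_inv, Perm.viaFintypeEmbedding_sign]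

theorem normalizedCharacter_eq_sum_embedding (hl : l ≤ μ.card) (π : Perm (Fin l)) :
    normalizedCharacter μ hl π
      = ∑ f : Fin l ↪ Box μ, (youngSymmetrizer μ).coeff (π.viaFintypeEmbedding f)⁻¹ := by
  have hbox : Fintype.card (Box μ) = μ.card := by rw [Fintype.card_coe, YoungDiagram.card]
  have key := card_embedding_mul_sum_perm
    ((Fin.castLEEmb hl).trans (numbering μ).toEmbedding)
    fun f => (youngSymmetrizer μ).coeff (π.viaFintypeEmbedding f)⁻¹
  rw [Fintype.card_embedding_eq, Fintype.card_perm, Fintype.card_fin, hbox] at key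
  have hsum : ∑ h : Perm (Box μ), (youngSymmetrizer μ).coeff
        (h⁻¹ * ((numbering μ).permCongr (π.viaFintypeEmbedding (Fin.castLEEmb hl)))⁻¹ * h)
      = ∑ h : Perm (Box μ), (youngSymmetrizer μ).coeff (π.viaFintypeEmbedding
          (((Fin.castLEEmb hl).trans (numbering μ).toEmbedding).trans h.toEmbedding))⁻¹ := by
    -- Replacing `h` by `h⁻¹` turns `h⁻¹ g h` into the relabelling of `g` by `h`.
    refine Fintype.sum_equiv (Equiv.inv _) _ _ fun h => ?_
    rw [← permCongr_viaFintypeEmbedding, ← permCongr_viaFintypeEmbedding]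
    congr 1
  have hfac : (Nat.factorial μ.card : ℂ) ≠ 0 := Nat.cast_ne_zero.2 (Nat.factorial_ne_zero _)
  rw [normalizedCharacter, chi_eq_sum_coeff, hsum, mul_left_comm, key, ← mul_assoc,
    inv_mul_cancel₀ hfac, one_mul]

/-- If `f a = f b`, then `σ ↦ swap a b * σ` keeps the preservation condition and reverses the sign.
-/
theorem sum_preserves_eq_zero {f : Fin l → Box μ} (hf : ¬ Function.Injective f)
    (π : Perm (Fin l)) :
    ∑ σ : Perm (Fin l),
      (if Preserves f σ (σ * π) then ((Perm.sign (σ * π) : ℤ) : ℂ) else 0) = 0 := by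
  rw [Function.Injective] at hf
  push Not at hf
  obtain ⟨a, b, hab, hne⟩ := hf
  have hs : ∀ x, f (swap a b x) = f x := apply_swap_eq_self hab
  have hsum : ∀ S : ℂ, S = -S → S = 0 := fun S h => by linear_combination (1 / 2 : ℂ) * h
  apply hsum
  rw [← sum_neg_distrib]
  refine Fintype.sum_equiv (Equiv.mulLeft (swap a b)) _ _ fun σ => ?_
  have hiff : Preserves f (swap a b * σ) (swap a b * (σ * π)) ↔ Preserves f σ (σ * π) := by
    simp [Preserves, hs]
  simp only [coe_mulLeft, mul_assoc (swap a b), hiff, Perm.sign_mul (swap a b), Perm.sign_swap hne]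
  split_ifs <;> simp

/-- The normalized character as a signed count of box labellings. -/
theorem normalizedCharacter_eq_sum (hl : l ≤ μ.card) (π : Perm (Fin l)) :
    normalizedCharacter μ hl π
      = ∑ σ : Perm (Fin l), ((Perm.sign (σ * π) : ℤ) : ℂ) *
          (Fintype.card {f : Fin l → Box μ // Preserves f σ (σ * π)} : ℂ) := by
  rw [normalizedCharacter_eq_sum_embedding]
  simp only [coeff_youngSymmetrizer_viaFintypeEmbedding]
  have h : ∀ F : (Fin l → Box μ) → ℂ, (∀ f, ¬ Function.Injective f → F f = 0) →
      ∑ f : Fin l ↪ Box μ, F f = ∑ f : Fin l → Box μ, F f := by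
    intro F hF
    rw [← sum_filter_of_ne fun f _ h => not_imp_comm.1 (hF f) h]
    refine sum_nbij (fun f => (f : Fin l → Box μ)) ?_ ?_ ?_ ?_
    · intro f _
      exact mem_filter.2 ⟨mem_univ _, f.injective⟩
    · exact DFunLike.coe_injective.injOn
    · intro f hf
      exact ⟨⟨f, (mem_filter.1 hf).2⟩, mem_univ _, rfl⟩
    · intros
      rfl
  rw [h _ fun f hf => sum_preserves_eq_zero hf π, sum_comm]
  refine sum_congr rfl fun σ _ => ?_
  rw [← sum_filter, sum_const, nsmul_eq_mul, mul_comm, Fintype.card_subtype]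

end Functions

/-! ### Cycles, signs and invariant functions. -/

section Cycles

variable {l : ℕ}

theorem card_cycles (τ : Perm (Fin l)) :
    Fintype.card (Cycles τ) = #τ.cycleFactorsFinset + #{a | τ a = a} := by
  classical
  let L : Cycles τ → Perm (Fin l) :=
    Quotient.lift (fun a => τ.cycleOf a) fun a b h => Perm.SameCycle.cycleOf_eq h
  have hL : ∀ a, L (Quotient.mk _ a) = τ.cycleOf a := fun _ => rfl
  have h1 : #{c : Cycles τ | L c ≠ 1} = #τ.cycleFactorsFinset := by
    refine card_nbij L ?_ ?_ ?_
    · intro c hc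
      induction c using Quotient.inductionOn with | h a => ?_
      rw [mem_coe, mem_filter, hL, Ne, Perm.cycleOf_eq_one_iff] at hc
      rw [hL, mem_coe, Perm.cycleOf_mem_cycleFactorsFinset_iff, Perm.mem_support]
      exact hc.2
    · intro c hc d hd h
      induction c using Quotient.inductionOn with | h a => ?_
      induction d using Quotient.inductionOn with | h b => ?_
      rw [mem_coe, mem_filter, hL, Ne, Perm.cycleOf_eq_one_iff] at hc
      rw [hL, hL] at h
      have hb : a ∈ (τ.cycleOf b).support := by
        rw [← h, Perm.mem_support_cycleOf_iff]
        exact ⟨Perm.SameCycle.refl _ _, Perm.mem_support.2 hc.2⟩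
      exact Quotient.sound (Perm.mem_support_cycleOf_iff.1 hb).1.symm
    · intro ρ hρ
      obtain ⟨a, ha⟩ := (Perm.mem_cycleFactorsFinset_iff.1 hρ).1.nonempty_support
      have hρa := Perm.cycle_is_cycleOf ha hρ
      refine ⟨Quotient.mk _ a, ?_, hρa.symm⟩
      rw [mem_coe, mem_filter, hL, ← hρa]
      exact ⟨mem_univ _, (Perm.mem_cycleFactorsFinset_iff.1 hρ).1.ne_one⟩
  have h2 : #{a | τ a = a} = #{c : Cycles τ | ¬ L c ≠ 1} := by
    refine card_nbij (fun a => Quotient.mk _ a) ?_ ?_ ?_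
    · intro a ha
      rw [mem_coe, mem_filter] at ha ⊢
      rw [not_not, hL, Perm.cycleOf_eq_one_iff]
      exact ⟨mem_univ _, ha.2⟩
    · intro a ha b _ h
      exact (Quotient.exact h : τ.SameCycle a b).eq_of_left (mem_filter.1 ha).2
    · intro c hc
      induction c using Quotient.inductionOn with | h a => ?_
      rw [mem_coe, mem_filter, not_not, hL, Perm.cycleOf_eq_one_iff] at hc
      exact ⟨a, mem_filter.2 ⟨mem_univ _, hc.2⟩, rfl⟩
  rw [← h1, h2, card_filter_add_card_filter_not, card_univ]

theorem sign_eq_neg_one_pow (τ : Perm (Fin l)) :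
    Perm.sign τ = (-1) ^ (l + Fintype.card (Cycles τ)) := by
  have h : #τ.support + #{a | τ a = a} = l := by
    have := card_filter_add_card_filter_not (s := (univ : Finset (Fin l))) (fun a => τ a ≠ a)
    simpa [Perm.support] using this
  have hct : Multiset.card τ.cycleType = #τ.cycleFactorsFinset := by
    rw [Perm.cycleType_def, Multiset.card_map, card_val]
  -- Each fixed point counts both as a letter and as a cycle, so fixed points do not affect the
  -- parity.
  have he : l + Fintype.card (Cycles τ)
      = #τ.support + #τ.cycleFactorsFinset + 2 * #{a | τ a = a} := by
    rw [card_cycles]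
    omega
  rw [Perm.sign_of_cycleType, Perm.sum_cycleType, hct, he, pow_add _ _ (2 * _), pow_mul]
  simp

instance (σ : Perm (Fin l)) : DecidableEq (Cycles σ) := Classical.decEq _

/-- Functions invariant under a permutation are functions on its cycles. -/
def invariantEquiv {X : Type*} (σ : Perm (Fin l)) :
    {k : Fin l → X // ∀ a, k (σ a) = k a} ≃ (Cycles σ → X) where
  toFun k := Quotient.lift k.1 fun a b h => by
    obtain ⟨n, rfl⟩ := (h : σ.SameCycle a b).exists_nat_pow_eq
    clear h
    induction n with
    | zero => rfl
    | succ n ih => rw [pow_succ', Perm.mul_apply, k.2, ← ih]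
  invFun K := ⟨fun a => K (Quotient.mk _ a), fun a =>
    congrArg K (Quotient.sound (Perm.SameCycle.refl σ a).apply_left)⟩
  left_inv _ := rfl
  right_inv K := by
    funext c
    induction c using Quotient.inductionOn with | h a => rfl

end Cycles

/-! ### Counting labellings of a multirectangular diagram. -/

section Multirectangular

variable {r : ℕ}

/-- Only row lengths matter for the count, so any bijection matching rows with equal lengths serves;
it exists because each length occurs equally often on both sides. -/
theorem exists_rowsEquiv (p q : Fin r → ℕ) :
    ∃ e : Fin (multirectRows p q).length ≃ Σ k : Fin r, Fin (p k),
      ∀ i, q (e i).1 = (multirectRows p q)[i] := by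
  have hcard : ∀ v, Fintype.card {i : Fin (multirectRows p q).length // (multirectRows p q).get i = v}
      = Fintype.card {x : Σ k : Fin r, Fin (p k) // q x.1 = v} := by
    intro v
    have h1 : Fintype.card {i : Fin (multirectRows p q).length // (multirectRows p q).get i = v}
        = (multirectRows p q).count v := by
      rw [Fintype.card_subtype]
      conv_rhs => rw [← List.ofFn_get (multirectRows p q), ← Multiset.coe_count,
        ← Fin.univ_val_map, Multiset.count_map]
      simp only [card_def, filter_val, eq_comm]
    rw [h1, Fintype.card_subtype, card_filter, Fintype.sum_sigma, multirectRows,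
      List.count_flatten, List.map_ofFn, List.sum_ofFn]
    refine sum_congr rfl fun k _ => ?_
    by_cases h : q k = v <;> simp [List.count_replicate, h]
  exact ⟨Equiv.ofFiberEquiv fun v => Fintype.equivOfCardEq (hcard v),
    fun i => Equiv.ofFiberEquiv_map (g := fun x : Σ k : Fin r, Fin (p k) => q x.1) _ i⟩

variable {l : ℕ}

/-- The colored permutation given by a coloring of the cycles. -/
def coloredPermMk (σ : Perm (Fin l)) (φ : Cycles σ → Fin r) : ColoredPerm l r :=
  ⟨(σ, fun a => φ (Quotient.mk _ a)), fun _ _ h => congrArg φ (Quotient.sound h)⟩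

theorem color_coloredPermMk (σ : Perm (Fin l)) (φ : Cycles σ → Fin r) :
    (coloredPermMk σ φ).color = φ := by
  funext c
  induction c using Quotient.inductionOn with | h a => rfl

theorem sum_coloredPerm (F : ColoredPerm l r → ℂ) :
    ∑ x, F x = ∑ σ : Perm (Fin l), ∑ φ : Cycles σ → Fin r, F (coloredPermMk σ φ) := by
  rw [← Fintype.sum_sigma']
  symm
  refine Fintype.sum_bijective (fun y : Σ σ : Perm (Fin l), Cycles σ → Fin r =>
    coloredPermMk y.1 y.2) ⟨?_, ?_⟩ _ _ fun _ => rfl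
  · rintro ⟨σ, φ⟩ ⟨τ, ψ⟩ h
    obtain rfl : σ = τ := congrArg (fun x : ColoredPerm l r => x.perm) h
    congr 1
    funext c
    induction c using Quotient.inductionOn with | h a => ?_
    exact congrArg (fun x : ColoredPerm l r => x.1.2 a) h
  · intro x
    exact ⟨⟨x.perm, x.color⟩, rfl⟩

/-- This is where the maximum in `ψ` comes from: as `q` is antitone, the tightest bound along a
cycle is at its largest color, which is attained. -/
theorem forall_lt_color_mulPerm_iff {q : Fin r → ℕ} (hq : Antitone q) (x : ColoredPerm l r)
    (π : Perm (Fin l)) (M : Cycles (x.mulPerm π).perm → ℕ) :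
    (∀ c, M c < q ((x.mulPerm π).color c)) ↔ ∀ a, M (Quotient.mk _ a) < q (x.1.2 a) := by
  constructor
  · intro h a
    refine (h (Quotient.mk _ a)).trans_le (hq ?_)
    exact le_sup' x.1.2 (mem_filter.2 ⟨mem_univ _, Perm.SameCycle.refl _ a⟩)
  · intro h c
    induction c using Quotient.inductionOn with | h a => ?_
    obtain ⟨b, hb, hmax⟩ := exists_mem_eq_sup' (s := univ.filter fun b => (x.perm * π).SameCycle a b)
      ⟨a, by simp [Perm.SameCycle.refl]⟩ x.1.2
    have hc : (x.mulPerm π).color (Quotient.mk _ a) = x.1.2 b := hmax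
    rw [hc, Quotient.sound (show _ from (mem_filter.1 hb).2)]
    exact h b

/-- A box labelling amounts to a choice of rows and a choice of columns. -/
def labellingEquiv (p q : Fin r → ℕ) (hq : Antitone q)
    (e : Fin (multirectRows p q).length ≃ Σ k : Fin r, Fin (p k))
    (he : ∀ i, q (e i).1 = (multirectRows p q)[i]) (σ τ : Perm (Fin l)) :
    {f : Fin l → Box (multirect p q hq) // Preserves f σ τ} ≃
      {km : {k : Fin l → Σ k : Fin r, Fin (p k) // ∀ a, k (σ a) = k a} ×
        {m : Fin l → ℕ // ∀ a, m (τ a) = m a} // ∀ a, km.2.1 a < q (km.1.1 a).1} where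
  toFun f := ⟨(⟨fun a => e ⟨(f.1 a).1.1, (YoungDiagram.mem_ofRowLens.1 (f.1 a).2).1⟩, fun a => by
      simp only [f.2.1 a]⟩, ⟨fun a => (f.1 a).1.2, f.2.2⟩), fun a => by
    rw [he]; exact (YoungDiagram.mem_ofRowLens.1 (f.1 a).2).2⟩
  invFun km := ⟨fun a => ⟨((e.symm (km.1.1.1 a)).1, km.1.2.1 a), YoungDiagram.mem_ofRowLens.2
      ⟨(e.symm (km.1.1.1 a)).2, by
        have := km.2 a
        rw [← e.apply_symm_apply (km.1.1.1 a), he] at this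
        exact this⟩⟩,
    fun a => by simp only [km.1.1.2], fun a => by simp only [km.1.2.2]⟩
  left_inv f := by
    ext a <;> simp
  right_inv km := Subtype.ext (Prod.ext (Subtype.ext (funext fun _ => e.apply_symm_apply _)) rfl)

theorem card_labelling (p q : Fin r → ℕ) (hq : Antitone q) (σ π : Perm (Fin l)) :
    (Fintype.card {f : Fin l → Box (multirect p q hq) // Preserves f σ (σ * π)} : ℂ)
      = ∑ φ : Cycles σ → Fin r, (∏ b : Cycles σ, (p (φ b) : ℂ)) *
          ∏ c : Cycles ((coloredPermMk σ φ).mulPerm π).perm,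
            (q (((coloredPermMk σ φ).mulPerm π).color c) : ℂ) := by
  obtain ⟨e, he⟩ := exists_rowsEquiv p q
  have E1 := labellingEquiv p q hq e he σ (σ * π)
  let E2 : {km : {k : Fin l → Σ k : Fin r, Fin (p k) // ∀ a, k (σ a) = k a} ×
        {m : Fin l → ℕ // ∀ a, m ((σ * π) a) = m a} // ∀ a, km.2.1 a < q (km.1.1 a).1} ≃
      {KM : (Σ φ : Cycles σ → Fin r, ∀ b, Fin (p (φ b))) × (Cycles (σ * π) → ℕ) //
        ∀ c, KM.2 c < q (((coloredPermMk σ KM.1.1).mulPerm π).color c)} :=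
    Equiv.subtypeEquiv (Equiv.prodCongr ((invariantEquiv σ).trans
      ⟨fun K => ⟨fun b => (K b).1, fun b => (K b).2⟩, fun K b => ⟨K.1 b, K.2 b⟩,
        fun _ => rfl, fun _ => rfl⟩) (invariantEquiv (σ * π))) fun km =>
      (forall_lt_color_mulPerm_iff hq (coloredPermMk σ fun b => (invariantEquiv σ km.1 b).1) π
        (invariantEquiv (σ * π) km.2)).symm
  let E3 : {KM : (Σ φ : Cycles σ → Fin r, ∀ b, Fin (p (φ b))) × (Cycles (σ * π) → ℕ) //
        ∀ c, KM.2 c < q (((coloredPermMk σ KM.1.1).mulPerm π).color c)} ≃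
      Σ φ : Cycles σ → Fin r, (∀ b, Fin (p (φ b))) ×
        ∀ c : Cycles (σ * π), Fin (q (((coloredPermMk σ φ).mulPerm π).color c)) :=
    { toFun := fun KM => ⟨KM.1.1.1, KM.1.1.2, fun c => ⟨KM.1.2 c, KM.2 c⟩⟩
      invFun := fun x => ⟨(⟨x.1, x.2.1⟩, fun c => (x.2.2 c).1), fun c => (x.2.2 c).2⟩
      left_inv := fun _ => rfl
      right_inv := fun _ => rfl }
  classical
  rw [Fintype.card_congr ((E1.trans E2).trans E3), Fintype.card_sigma, Nat.cast_sum]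
  refine sum_congr rfl fun φ _ => ?_
  rw [Fintype.card_prod, Fintype.card_pi, Fintype.card_pi, Nat.cast_mul, Nat.cast_prod,
    Nat.cast_prod]
  simp only [Fintype.card_fin]
  rfl

theorem sign_mul_prod {q : Fin r → ℕ} (x : ColoredPerm l r) :
    ((Perm.sign x.perm : ℤ) : ℂ) * ∏ c : Cycles x.perm, (q (x.color c) : ℂ)
      = (-1) ^ l * ∏ c : Cycles x.perm, (-(q (x.color c) : ℂ)) := by
  rw [prod_neg, sign_eq_neg_one_pow, card_univ]
  push_cast
  ring

end Multirectangular

end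

end StanleyFeray

theorem mainTheorem9 (r : ℕ) (p q : Fin r → ℕ) (hp : ∀ i, 0 < p i) (hq : ∀ i, 0 < q i)
    (hanti : Antitone q) (l : ℕ) (hl : l ≤ (StanleyFeray.multirect p q hanti).card)
    (π : Equiv.Perm (Fin l)) :
    StanleyFeray.normalizedCharacter (StanleyFeray.multirect p q hanti) hl π =
      (-1 : ℂ) ^ l * ∑ x : StanleyFeray.ColoredPerm l r,
        (∏ b : StanleyFeray.Cycles x.perm, (p (x.color b) : ℂ)) *
          ∏ c : StanleyFeray.Cycles (x.mulPerm π).perm, (-(q ((x.mulPerm π).color c) : ℂ)) := by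
  rw [StanleyFeray.normalizedCharacter_eq_sum, StanleyFeray.sum_coloredPerm, Finset.mul_sum]
  refine Finset.sum_congr rfl fun σ _ => ?_
  rw [StanleyFeray.card_labelling, Finset.mul_sum, Finset.mul_sum]
  refine Finset.sum_congr rfl fun φ _ => ?_
  have h := StanleyFeray.sign_mul_prod (q := q) ((StanleyFeray.coloredPermMk σ φ).mulPerm π)
  rw [mul_left_comm ((-1 : ℂ) ^ l), ← h, StanleyFeray.color_coloredPermMk]
  exact mul_left_comm _ _ _
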